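/- **Theorem (Attractiveness of the discrete KMP model).** Let $N\ge 1$, let $\mathbb T_N=\mathbb Z/N\mathbb Z$ be the discrete torus and let $\Omega_N=\mathbb N_0^{\mathbb T_N}$, with $\mathbb N_0=\{0,1,2,\dots\}$, be the space of particle configurations, ordered coordinatewise. The discrete KMP generator acts on functions $f:\Omega_N\to\mathbb R$ by $$ L_N f(\eta)=\sum_{x\in\mathbb T_N}\frac{1}{\eta_x+\eta_{x+1}+1}\sum_{r=0}^{\eta_x+\eta_{x+1}}\bigl[f(\eta^{x,x+1,r})-f(\eta)\bigr], $$ where $\eta^{x,x+1,r}$ is the configuration with $r$ particles at $x$, $\eta_x+\eta_{x+1}-r$ particles at $x+1$, and $\eta_z$ particles at every other site $z$ (for $N=1$, where $x+1=x$, we set $\eta^{x,x+1,r}=\eta$). In other words, on each bond the particles are redistributed uniformly at rate $1$; equivalently, each bond $(x,x+1)$, $x\in\mathbb T_N$, lets $k\ge 1$ particles jump from either end $y$ to the other end $z$ at rate $c^k_{y,z}(\eta)=\frac{1}{\eta_y+\eta_z+1}\mathbf 1_{\{k\le \eta_y\}}$. For probability measures $\mu_1,\mu_2$ on $\Omega_N$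 write $\mu_1\le\mu_2$ if $E_{\mu_1}[f]\le E_{\mu_2}[f]$ for every bounded $f:\Omega_N\to\mathbb R$ that is monotone (that is, $f(\eta)\le f(\xi)$ whenever $\eta\le\xi$). Then there is a Markov semigroup $\{S(t):t\ge 0\}$ of transition kernels on $\Omega_N$ with generator $L_N$, in the sense that $(S(t)f-f)/t\to L_Nf$ uniformly on $\Omega_N$ as $t\downarrow 0$ for every bounded $f$. Every such semigroup is attractive: if $\mu_1,\mu_2$ are probability measures on $\Omega_N$ with $\mu_1\le\mu_2$, then $S(t)\mu_1\le S(t)\mu_2$ for all $t\ge 0$. -/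

import Mathlib

open MeasureTheory ProbabilityTheory Filter Topology
open scoped NNReal

noncomputable section

namespace DiscreteKMP

/-- Particle configurations on the discrete torus with `N` sites; the order is the
coordinatewise one, and every set of configurations is measurable (the space is countable). -/
abbrev Config (N : ℕ) : Type := ZMod N → ℕ

/-- The configuration obtained from `η` by putting `r` of the `η x + η y` particles of the bond
`{x, y}` at `x` and the remaining ones at `y`. If `x = y` (this happens only on the torus with
one site) there is nothing to redistribute and the configuration does not change. -/
def redistribute {N : ℕ} (η : Config N) (x y : ZMod N) (r : ℕ) : Config N :=
  if x = y then η
  else Function.update (Function.update η x r) y (η x + η y - r)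

/-- The generator of the bond `{x, y}`: at rate `1` the number of particles at `x` becomes
uniform on `{0, …, η x + η y}`. -/
def bondGenerator {N : ℕ} (x y : ZMod N) (f : Config N → ℝ) (η : Config N) : ℝ :=
  (1 / ((η x : ℝ) + (η y : ℝ) + 1)) *
    ∑ r ∈ Finset.range (η x + η y + 1), (f (redistribute η x y r) - f η)

/-- The generator of the discrete KMP model on the torus with `N` sites. -/
def generator (N : ℕ) [NeZero N] (f : Config N → ℝ) (η : Config N) : ℝ :=
  ∑ x : ZMod N, bondGenerator x (x + 1) f η

/-- A Markov semigroup on the configuration space, given by its transition kernels. It acts on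
bounded functions by `(S(t) f)(η) = ∫ ξ, f ξ ∂(S t η)` and on measures by
`S(t) μ = μ.bind (S t)`. -/
structure IsMarkovSemigroup {N : ℕ} (S : ℝ≥0 → Kernel (Config N) (Config N)) : Prop where
  markov : ∀ t, IsMarkovKernel (S t)
  zero : S 0 = Kernel.id
  add : ∀ s t, S (s + t) = S s ∘ₖ S t

/-- `L` is the infinitesimal generator of the semigroup `S` on the Banach space of bounded
functions: `(S(t) f - f) / t → L f` uniformly as `t ↓ 0`, for every bounded `f`. -/
def HasGenerator {N : ℕ} (S : ℝ≥0 → Kernel (Config N) (Config N))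
    (L : (Config N → ℝ) → Config N → ℝ) : Prop :=
  ∀ f : Config N → ℝ, (∃ C : ℝ, ∀ η, |f η| ≤ C) →
    TendstoUniformly (fun (t : ℝ≥0) (η : Config N) => ((∫ ξ, f ξ ∂(S t η)) - f η) / (t : ℝ))
      (L f) (𝓝[>] (0 : ℝ≥0))

/-- The stochastic order: `μ₁ ≤ μ₂` if `E_{μ₁}[f] ≤ E_{μ₂}[f]` for all bounded monotone `f`. -/
def StochLE {N : ℕ} (μ₁ μ₂ : Measure (Config N)) : Prop :=
  ∀ f : Config N → ℝ, (∃ C : ℝ, ∀ η, |f η| ≤ C) → Monotone f →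
    ∫ η, f η ∂μ₁ ≤ ∫ η, f η ∂μ₂

/-- A semigroup is attractive if it preserves the stochastic order of probability measures. -/
def IsAttractive {N : ℕ} (S : ℝ≥0 → Kernel (Config N) (Config N)) : Prop :=
  ∀ μ₁ μ₂ : Measure (Config N), IsProbabilityMeasure μ₁ → IsProbabilityMeasure μ₂ →
    StochLE μ₁ μ₂ → ∀ t : ℝ≥0, StochLE (μ₁.bind (S t)) (μ₂.bind (S t))

end DiscreteKMP

end

/-! Each bond rings at rate one, so the generator is `N • (P - 1)`, where `P` redistributes
uniformly on a uniformly chosen bond. This operator is bounded on bounded functions. Hence `exp (t N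
(P - 1))` is a Poisson mixture of the powers of `P`: it is given by Markov kernels, which settles
existence, and it preserves monotone functions as soon as `P` does.

Monotonicity of `P` reduces to one bond and there to `monotone_splitAverage`: the uniform splitting
of `n` particles can be coupled below that of `n + 1` by adding one particle to a suitably chosen
side.

Attractiveness is claimed for every semigroup with this generator, so uniqueness is needed as well:
`eq_expSemigroup_of_tendsto_generator` identifies any such semigroup with the exponential through
uniqueness for the linear ODE `u' = A u`. Integrating a monotone function against the transition
kernels then gives a monotone function, to which the order of the initial laws applies. -/

open scoped BoundedContinuousFunction Nat

noncomputable section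

namespace DiscreteKMP

/-! ### Semigroups with a bounded generator -/

section Semigroup

variable {E : Type*} [NormedAddCommGroup E] [NormedSpace ℝ E] [CompleteSpace E]

/-- The uniformly continuous semigroup `exp (t A)` with bounded generator `A`. -/
def expSemigroup (A : E →L[ℝ] E) (t : ℝ) : E →L[ℝ] E := NormedSpace.exp (t • A)

omit [CompleteSpace E] in
lemma expSemigroup_zero (A : E →L[ℝ] E) : expSemigroup A 0 = 1 := by
  simp [expSemigroup]

lemma expSemigroup_add (A : E →L[ℝ] E) (s t : ℝ) :
    expSemigroup A (s + t) = expSemigroup A s * expSemigroup A t := by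
  let _ : NormedAlgebra ℚ (E →L[ℝ] E) := NormedAlgebra.restrictScalars ℚ ℝ _
  rw [expSemigroup, add_smul, NormedSpace.exp_add_of_commute]
  · rfl
  · exact ((Commute.refl _).smul_left _).smul_right _

omit [CompleteSpace E] in
lemma expSemigroup_smul (A : E →L[ℝ] E) (r t : ℝ) :
    expSemigroup (r • A) t = expSemigroup A (t * r) := by
  rw [expSemigroup, expSemigroup, smul_smul]

/-- `exp (s (T - 1))` is the Poisson mixture of the powers of `T`. -/
lemma hasSum_expSemigroup_sub_one (T : E →L[ℝ] E) (s : ℝ) (f : E) :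
    HasSum (fun k : ℕ => (Real.exp (-s) * s ^ k / k !) • (T ^ k) f)
      (expSemigroup (T - 1) s f) := by
  rw [expSemigroup]
  have h1 : NormedSpace.exp (s • (T - 1)) = Real.exp (-s) • NormedSpace.exp (s • T) := by
    let _ : NormedAlgebra ℚ (E →L[ℝ] E) := NormedAlgebra.restrictScalars ℚ ℝ _
    have h2 : s • (T - 1) = algebraMap ℝ (E →L[ℝ] E) (-s) + s • T := by
      rw [Algebra.algebraMap_eq_smul_one, smul_sub, neg_smul]; abel
    rw [h2, NormedSpace.exp_add_of_commute (Algebra.commutes _ _),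
      ← NormedSpace.algebraMap_exp_comm, ← Real.exp_eq_exp_ℝ, Algebra.algebraMap_eq_smul_one,
      smul_mul_assoc, one_mul]
  rw [h1]
  have h := (NormedSpace.exp_series_hasSum_exp' (𝕂 := ℝ) (s • T)).const_smul (Real.exp (-s))
  convert! h.mapL (ContinuousLinearMap.apply ℝ E f) using 2 with k
  rw [smul_pow, smul_smul, smul_smul]
  simp only [ContinuousLinearMap.apply_apply, smul_apply]
  congr 1
  ring

lemma hasDerivAt_expSemigroup_apply (A : E →L[ℝ] E) (f : E) (r : ℝ) :
    HasDerivAt (fun r : ℝ => expSemigroup A r f) (A (expSemigroup A r f)) r := by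
  simpa [expSemigroup] using (hasDerivAt_exp_smul_const' (𝕂 := ℝ) A r).clm_apply (hasDerivAt_const r f)

/-- A strongly continuous contraction semigroup whose generator is a bounded operator `A` is the
exponential of `A`. -/
lemma eq_expSemigroup_of_tendsto_generator (U : ℝ≥0 → E →L[ℝ] E) (A : E →L[ℝ] E) (h0 : U 0 = 1)
    (hadd : ∀ s t, U (s + t) = U s * U t) (hU : ∀ t, ‖U t‖ ≤ 1)
    (hA : ∀ f, Tendsto (fun t : ℝ≥0 => (t : ℝ)⁻¹ • (U t f - f)) (𝓝[>] 0) (𝓝 (A f)))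
    (t : ℝ≥0) : U t = expSemigroup A t := by
  have hcont0 (f : E) : Tendsto (fun t : ℝ≥0 => U t f) (𝓝 0) (𝓝 f) := by
    have h1 : Tendsto (fun t : ℝ≥0 => U t f) (𝓝[>] 0) (𝓝 f) := by
      have h2 : Tendsto (fun t : ℝ≥0 => (t : ℝ)) (𝓝[>] 0) (𝓝 0) := by
        have : Tendsto (fun t : ℝ≥0 => (t : ℝ)) (𝓝 0) (𝓝 ((0 : ℝ≥0) : ℝ)) :=
          NNReal.continuous_coe.tendsto 0
        exact this.mono_left nhdsWithin_le_nhds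
      have h3 := (h2.smul (hA f)).add_const f
      rw [zero_smul, zero_add] at h3
      refine h3.congr' ?_
      filter_upwards [self_mem_nhdsWithin] with t (ht : 0 < t)
      have : (t : ℝ) ≠ 0 := by exact_mod_cast ht.ne'
      rw [smul_smul, mul_inv_cancel₀ this, one_smul, sub_add_cancel]
    -- The limit `hA` only sees `t > 0`; the point `t = 0` is covered separately by `h0`.
    have h4 : 𝓝 (0 : ℝ≥0) = pure 0 ⊔ 𝓝[>] 0 := by
      rw [← nhdsWithin_univ, ← nhdsWithin_singleton, ← nhdsWithin_union]
      congr 1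
      ext t
      simp
    rw [h4, tendsto_sup]
    refine ⟨?_, h1⟩
    rw [tendsto_pure_left]
    intro s hs
    simpa [h0] using mem_of_mem_nhds hs
  ext f
  set u : ℝ → E := fun r => U r.toNNReal f with hu
  -- Contractivity transports the modulus of continuity at time `0` to every time.
  have hdist (r h : ℝ≥0) : dist (U (r + h) f) (U r f) ≤ dist (U h f) f := by
    rw [dist_eq_norm, dist_eq_norm, hadd, mul_apply_eq_comp, ← map_sub]
    exact ((U r).le_opNorm _).trans (mul_le_of_le_one_left (norm_nonneg _) (hU r))
  have hdist' (r s : ℝ≥0) : dist (U r f) (U s f) ≤ dist (U (nndist r s) f) f := by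
    rcases le_total s r with h | h
    · obtain ⟨d, rfl⟩ := exists_add_of_le h
      convert hdist s d
      ext
      simp [NNReal.dist_eq]
    · obtain ⟨d, rfl⟩ := exists_add_of_le h
      rw [dist_comm]
      convert hdist r d
      ext
      simp [NNReal.dist_eq]
  have hcontU : Continuous fun r : ℝ≥0 => U r f := by
    rw [continuous_iff_continuousAt]
    intro s
    rw [ContinuousAt, tendsto_iff_dist_tendsto_zero]
    have h1 : Tendsto (fun r : ℝ≥0 => nndist r s) (𝓝 s) (𝓝 0) := by
      have : Continuous fun r : ℝ≥0 => nndist r s := by fun_prop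
      simpa using this.tendsto s
    have h2 := tendsto_iff_dist_tendsto_zero.1 ((hcont0 f).comp h1)
    exact squeeze_zero (fun _ => dist_nonneg) (fun r => hdist' r s) h2
  -- The semigroup law gives right derivatives only; with continuity, these suffice for ODE
  -- uniqueness.
  have hderiv (r : ℝ) (hr : 0 ≤ r) : HasDerivWithinAt u (A (u r)) (Set.Ici r) r := by
    rw [← hasDerivWithinAt_Ioi_iff_Ici, hasDerivWithinAt_iff_tendsto_slope' (by simp)]
    have h1 : Tendsto (fun y : ℝ => (y - r).toNNReal) (𝓝[>] r) (𝓝[>] 0) := by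
      refine tendsto_nhdsWithin_iff.2 ⟨?_, ?_⟩
      · have : Continuous fun y : ℝ => (y - r).toNNReal := by fun_prop
        have h := this.tendsto r
        simp only [sub_self, Real.toNNReal_zero] at h
        exact h.mono_left nhdsWithin_le_nhds
      · filter_upwards [self_mem_nhdsWithin] with y (hy : r < y)
        simpa using hy
    refine ((hA (u r)).comp h1).congr' ?_
    filter_upwards [self_mem_nhdsWithin] with y (hy : r < y)
    have h2 : y.toNNReal = (y - r).toNNReal + r.toNNReal := by
      rw [← Real.toNNReal_add (by linarith) hr]; simp
    simp only [Function.comp, slope, hu, vsub_eq_sub]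
    rw [h2, hadd, Real.coe_toNNReal _ (by linarith)]
    rfl
  have := ODE_solution_unique (v := fun _ => A) (K := ‖A‖₊) (a := 0) (b := t)
    (f := u) (g := fun r : ℝ => expSemigroup A r f) (fun _ => A.lipschitz)
    (hcontU.comp continuous_real_toNNReal).continuousOn (fun r hr => hderiv r hr.1)
    (fun r _ => (hasDerivAt_expSemigroup_apply A f r).continuousAt.continuousWithinAt)
    (fun r _ => (hasDerivAt_expSemigroup_apply A f r).hasDerivWithinAt) (by simp [hu, h0, expSemigroup_zero])
  simpa [hu] using this (Set.right_mem_Icc.2 t.2)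

lemma tendsto_expSemigroup_generator (A : E →L[ℝ] E) (f : E) :
    Tendsto (fun t : ℝ≥0 => (t : ℝ)⁻¹ • (expSemigroup A t f - f)) (𝓝[>] 0)
      (𝓝 (A f)) := by
  have h1 := (hasDerivAt_expSemigroup_apply A f 0).tendsto_slope_zero_right
  have h2 : Tendsto (fun t : ℝ≥0 => (t : ℝ)) (𝓝[>] 0) (𝓝[>] 0) := by
    refine tendsto_nhdsWithin_iff.2 ⟨?_, ?_⟩
    · exact (NNReal.continuous_coe.tendsto 0).mono_left nhdsWithin_le_nhds
    · filter_upwards [self_mem_nhdsWithin] with y (hy : 0 < y)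
      simpa using hy
  simpa [Function.comp_def, expSemigroup_zero] using h1.comp h2

end Semigroup

/-! ### Markov kernels as operators on bounded functions -/

section KernelOperator

variable {α β : Type*} [MeasurableSpace α] [DiscreteMeasurableSpace α]

lemma integrable_of_bounded (μ : Measure α) [IsFiniteMeasure μ] (f : α → ℝ) (C : ℝ)
    (hf : ∀ a, |f a| ≤ C) : Integrable f μ :=
  Integrable.of_bound Measurable.of_discrete.aestronglyMeasurable C (ae_of_all _ hf)

lemma integral_bind_of_bounded [MeasurableSpace β] (μ : Measure β) [IsProbabilityMeasure μ]
    (κ : Kernel β α) [IsMarkovKernel κ] (f : α → ℝ) (C : ℝ) (hf : ∀ a, |f a| ≤ C) :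
    ∫ a, f a ∂(μ.bind κ) = ∫ b, ∫ a, f a ∂(κ b) ∂μ := by
  have h := Kernel.integral_comp (η := κ) (κ := Kernel.const Unit μ) (a := ()) (f := f)
    (integrable_of_bounded _ f C hf)
  simpa [Kernel.comp_apply] using h

variable [TopologicalSpace α] [DiscreteTopology α]

/-- The action of a Markov kernel on bounded functions. -/
def kernelOperator (κ : Kernel α α) [IsMarkovKernel κ] : (α →ᵇ ℝ) →L[ℝ] (α →ᵇ ℝ) :=
  LinearMap.mkContinuous
    { toFun := fun f => BoundedContinuousFunction.ofNormedAddCommGroupDiscrete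
        (fun a => ∫ b, f b ∂(κ a)) ‖f‖ (fun a => by
          simpa using norm_integral_le_of_norm_le_const (μ := κ a) (ae_of_all _ f.norm_coe_le_norm))
      map_add' := fun f g => by
        ext a
        exact integral_add (integrable_of_bounded _ f ‖f‖ f.norm_coe_le_norm)
          (integrable_of_bounded _ g ‖g‖ g.norm_coe_le_norm)
      map_smul' := fun c f => by
        ext a
        exact integral_const_mul c _ }
    1 (fun f => by
      rw [one_mul, BoundedContinuousFunction.norm_le (norm_nonneg _)]
      intro a
      simpa using norm_integral_le_of_norm_le_const (μ := κ a) (ae_of_all _ f.norm_coe_le_norm))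

@[simp]
lemma kernelOperator_apply (κ : Kernel α α) [IsMarkovKernel κ] (f : α →ᵇ ℝ) (a : α) :
    kernelOperator κ f a = ∫ b, f b ∂(κ a) := rfl

lemma norm_kernelOperator_le (κ : Kernel α α) [IsMarkovKernel κ] : ‖kernelOperator κ‖ ≤ 1 :=
  LinearMap.mkContinuous_norm_le _ zero_le_one _

lemma kernelOperator_id : kernelOperator (Kernel.id : Kernel α α) = 1 := by
  ext f a
  simp [Kernel.id_apply]

/-- The action on functions is contravariant: the kernel applied last is integrated first. -/
lemma kernelOperator_comp (κ η : Kernel α α) [IsMarkovKernel κ] [IsMarkovKernel η] :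
    kernelOperator (η ∘ₖ κ) = kernelOperator κ * kernelOperator η := by
  ext f a
  exact Kernel.integral_comp (integrable_of_bounded _ f ‖f‖ f.norm_coe_le_norm)

/-- Indicators are bounded, and continuous since the space is discrete. This transfers the semigroup
identities from operators back to kernels. -/
lemma kernelOperator_injective (κ η : Kernel α α) [IsMarkovKernel κ] [IsMarkovKernel η]
    (h : kernelOperator κ = kernelOperator η) : κ = η := by
  ext a s hs
  have h1 := DFunLike.congr_fun (DFunLike.congr_fun h
    (BoundedContinuousFunction.ofNormedAddCommGroupDiscrete (s.indicator (fun _ => (1 : ℝ))) 1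
      (fun a => by by_cases ha : a ∈ s <;> simp [ha]))) a
  simp only [kernelOperator_apply, BoundedContinuousFunction.coe_ofNormedAddCommGroupDiscrete]
    at h1
  rw [integral_indicator_const _ hs, integral_indicator_const _ hs] at h1
  simpa [measureReal_def, ENNReal.toReal_eq_toReal_iff'] using h1

instance isMarkovKernel_pow (κ : Kernel α α) [IsMarkovKernel κ] (k : ℕ) :
    IsMarkovKernel (κ ^ k) := by
  induction k with
  | zero => exact inferInstanceAs (IsMarkovKernel Kernel.id)
  | succ k ih =>
    rw [pow_succ]
    exact inferInstanceAs (IsMarkovKernel ((κ ^ k) ∘ₖ κ))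

lemma kernelOperator_pow (κ : Kernel α α) [IsMarkovKernel κ] (k : ℕ) :
    kernelOperator (κ ^ k) = kernelOperator κ ^ k := by
  induction k with
  | zero => exact kernelOperator_id
  | succ k ih =>
    rw [pow_succ' (kernelOperator κ), ← ih]
    simp_rw [pow_succ κ]
    exact kernelOperator_comp κ (κ ^ k)

/-- The transition kernel after time `s` of the chain jumping according to `κ` at rate `1`. -/
def poissonKernel (κ : Kernel α α) (s : ℝ≥0) : Kernel α α where
  toFun a := (poissonMeasure s).bind fun k => (κ ^ k) a
  measurable' := .of_discrete

instance (κ : Kernel α α) [IsMarkovKernel κ] (s : ℝ≥0) : IsMarkovKernel (poissonKernel κ s) := by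
  refine ⟨fun a => ?_⟩
  let κ' : Kernel ℕ α := ⟨fun k => (κ ^ k) a, .of_discrete⟩
  have : IsMarkovKernel κ' := ⟨fun k => inferInstanceAs (IsProbabilityMeasure ((κ ^ k) a))⟩
  exact inferInstanceAs (IsProbabilityMeasure ((poissonMeasure s).bind κ'))

lemma hasSum_expSemigroup_kernelOperator (κ : Kernel α α) [IsMarkovKernel κ] (s : ℝ)
    (f : α →ᵇ ℝ) (a : α) :
    HasSum (fun k : ℕ => (Real.exp (-s) * s ^ k / k !) * (kernelOperator κ ^ k) f a)
      (expSemigroup (kernelOperator κ - 1) s f a) :=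
  (hasSum_expSemigroup_sub_one (kernelOperator κ) s f).mapL
    (BoundedContinuousFunction.evalCLM ℝ a)

lemma kernelOperator_poissonKernel (κ : Kernel α α) [IsMarkovKernel κ] (s : ℝ≥0) :
    kernelOperator (poissonKernel κ s) =
      expSemigroup (kernelOperator κ - 1) s := by
  ext f a
  let κ' : Kernel ℕ α := ⟨fun k => (κ ^ k) a, .of_discrete⟩
  have : IsMarkovKernel κ' := ⟨fun k => inferInstanceAs (IsProbabilityMeasure ((κ ^ k) a))⟩
  have h1 : kernelOperator (poissonKernel κ s) f a
      = ∫ k, (kernelOperator κ ^ k) f a ∂(poissonMeasure s) := by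
    refine (integral_bind_of_bounded (poissonMeasure s) κ' f ‖f‖ f.norm_coe_le_norm).trans ?_
    simp_rw [← kernelOperator_pow]
    rfl
  rw [h1, integral_poissonMeasure]
  simpa using (hasSum_expSemigroup_kernelOperator κ s f a).tsum_eq

/-- If the jump kernel preserves monotone functions, so does the jump process. -/
lemma monotone_expSemigroup_kernelOperator [Preorder α] (κ : Kernel α α) [IsMarkovKernel κ]
    (hκ : ∀ f : α →ᵇ ℝ, Monotone f → Monotone (kernelOperator κ f)) (s : ℝ≥0) (f : α →ᵇ ℝ)
    (hf : Monotone f) :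
    Monotone ⇑(expSemigroup (kernelOperator κ - 1) s f) := by
  have hpow (k : ℕ) : Monotone ((kernelOperator κ ^ k) f) := by
    induction k with
    | zero => simpa using hf
    | succ k ih =>
      rw [pow_succ']
      exact hκ _ ih
  intro a b hab
  refine hasSum_le (fun k => ?_) (hasSum_expSemigroup_kernelOperator κ s f a)
    (hasSum_expSemigroup_kernelOperator κ s f b)
  exact mul_le_mul_of_nonneg_left (hpow k hab) (by positivity)

end KernelOperator

/-! ### Uniform mixtures of measures -/

section Average

variable {ι α : Type*} [MeasurableSpace α]

/-- The uniform mixture of the measures `m i`, `i ∈ s`. -/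
def uniformMixture (s : Finset ι) (m : ι → Measure α) : Measure α :=
  (s.card : ENNReal)⁻¹ • ∑ i ∈ s, m i

lemma isProbabilityMeasure_uniformMixture (s : Finset ι) (hs : s.Nonempty) (m : ι → Measure α)
    (hm : ∀ i, IsProbabilityMeasure (m i)) : IsProbabilityMeasure (uniformMixture s m) := by
  refine ⟨?_⟩
  simp only [uniformMixture, Measure.smul_apply, Measure.finsetSum_apply, measure_univ,
    Finset.sum_const, nsmul_eq_mul, mul_one, smul_eq_mul]
  exact ENNReal.inv_mul_cancel (by simpa using hs.ne_empty) (by simp)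

lemma integral_uniformMixture [DiscreteMeasurableSpace α] (s : Finset ι) (m : ι → Measure α)
    (hm : ∀ i, IsProbabilityMeasure (m i)) (f : α → ℝ) (C : ℝ) (hf : ∀ a, |f a| ≤ C) :
    ∫ a, f a ∂(uniformMixture s m) = (s.card : ℝ)⁻¹ * ∑ i ∈ s, ∫ a, f a ∂(m i) := by
  rw [uniformMixture, integral_smul_measure,
    integral_finsetSum_measure (fun i _ => integrable_of_bounded _ f C hf)]
  simp

end Average

/-! ### Monotonicity of the redistribution on one bond -/

section Bond

/-- The average of `g` over the ways of splitting `n` into two ordered parts. -/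
def splitAverage (g : ℕ → ℕ → ℝ) (n : ℕ) : ℝ :=
  ((n : ℝ) + 1)⁻¹ * ∑ r ∈ Finset.range (n + 1), g r (n - r)

lemma splitAverage_mono_left {g h : ℕ → ℕ → ℝ} (hgh : ∀ a b, g a b ≤ h a b) (n : ℕ) :
    splitAverage g n ≤ splitAverage h n :=
  mul_le_mul_of_nonneg_left (Finset.sum_le_sum fun _ _ => hgh _ _) (by positivity)

/-- A uniform splitting of `n` is dominated by a uniform splitting of `n + 1`: given the
splitting `(r, n - r)`, increase the first part with probability `(r + 1) / (n + 2)` and the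
second one otherwise. -/
lemma monotone_splitAverage {g : ℕ → ℕ → ℝ} (h1 : ∀ b, Monotone fun a => g a b)
    (h2 : ∀ a, Monotone (g a)) : Monotone (splitAverage g) := by
  refine monotone_nat_of_le_succ fun n => ?_
  have hsum : ((n : ℝ) + 2) * ∑ r ∈ Finset.range (n + 1), g r (n - r)
      ≤ ((n : ℝ) + 1) * ∑ r ∈ Finset.range (n + 2), g r (n + 1 - r) := by
    calc ((n : ℝ) + 2) * ∑ r ∈ Finset.range (n + 1), g r (n - r)
        ≤ ∑ r ∈ Finset.range (n + 1), (((n : ℝ) + 1 - r) * g r (n + 1 - r)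
            + ((r : ℝ) + 1) * g (r + 1) (n + 1 - (r + 1))) := by
          rw [Finset.mul_sum]
          refine Finset.sum_le_sum fun r hr => ?_
          have hr' : (r : ℝ) ≤ n := by
            exact_mod_cast Nat.lt_succ_iff.1 (Finset.mem_range.1 hr)
          have ha : g r (n - r) ≤ g r (n + 1 - r) := h2 r (by omega)
          have hb : g r (n - r) ≤ g (r + 1) (n + 1 - (r + 1)) := by
            rw [Nat.add_sub_add_right]
            exact h1 _ (Nat.le_succ r)
          -- The coupling weights satisfy `(n + 1 - r) + (r + 1) = n + 2`.
          nlinarith [mul_le_mul_of_nonneg_left ha (by linarith : (0 : ℝ) ≤ (n : ℝ) + 1 - r),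
            mul_le_mul_of_nonneg_left hb (by positivity : (0 : ℝ) ≤ (r : ℝ) + 1)]
      _ = ∑ r ∈ Finset.range (n + 2), ((n : ℝ) + 1 - r) * g r (n + 1 - r)
            + ∑ r ∈ Finset.range (n + 2), (r : ℝ) * g r (n + 1 - r) := by
          -- The first weight vanishes at `r = n + 1` and the shifted second one at `r = 0`, so both
          -- sums extend to the full range. The total weight of each `r` is then `n + 1`, which
          -- makes the image uniform.
          rw [Finset.sum_add_distrib, Finset.sum_range_succ _ (n + 1),
            Finset.sum_range_succ' (fun r => (r : ℝ) * g r (n + 1 - r)) (n + 1)]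
          simp
      _ = ((n : ℝ) + 1) * ∑ r ∈ Finset.range (n + 2), g r (n + 1 - r) := by
          rw [← Finset.sum_add_distrib, Finset.mul_sum]
          refine Finset.sum_congr rfl fun r _ => ?_
          ring
  rw [splitAverage, splitAverage, inv_mul_le_iff₀ (by positivity), mul_left_comm,
    le_inv_mul_iff₀ (by positivity)]
  push_cast
  convert! hsum using 1
  ring

variable {N : ℕ}

/-- The average of `f` over the uniform redistributions on the bond `{x, y}`. -/
def bondAverage (x y : ZMod N) (f : Config N → ℝ) (η : Config N) : ℝ :=
  ((η x : ℝ) + η y + 1)⁻¹ * ∑ r ∈ Finset.range (η x + η y + 1), f (redistribute η x y r)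

lemma bondGenerator_eq (x y : ZMod N) (f : Config N → ℝ) (η : Config N) :
    bondGenerator x y f η = bondAverage x y f η - f η := by
  have : (η x : ℝ) + η y + 1 ≠ 0 := by positivity
  rw [bondGenerator, bondAverage, Finset.sum_sub_distrib, Finset.sum_const, Finset.card_range,
    nsmul_eq_mul]
  push_cast
  field_simp

lemma monotone_bondAverage (x y : ZMod N) {f : Config N → ℝ} (hf : Monotone f) :
    Monotone (bondAverage x y f) := by
  rcases eq_or_ne x y with rfl | hxy
  · have : bondAverage x x f = f := by
      ext η
      have : (η x : ℝ) + η x + 1 ≠ 0 := by positivity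
      simp only [bondAverage, redistribute, if_true, Finset.sum_const, Finset.card_range,
        nsmul_eq_mul]
      push_cast
      field_simp
    rwa [this]
  · have heq (η : Config N) : bondAverage x y f η =
        splitAverage (fun a b => f (Function.update (Function.update η x a) y b))
          (η x + η y) := by
      simp [bondAverage, splitAverage, redistribute, hxy]
    intro η ξ h
    rw [heq, heq]
    -- First the configuration off the bond is raised from `η` to `ξ`, then the number of particles
    -- on the bond.
    refine (splitAverage_mono_left (fun a b => hf ?_) _).trans
      (monotone_splitAverage (fun b a a' ha => hf ?_) (fun a b b' hb => hf ?_)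
        (add_le_add (h x) (h y)))
    · exact update_le_update_iff.2 ⟨le_rfl, fun z _ =>
        update_le_update_iff.2 ⟨le_rfl, fun w _ => h w⟩ z⟩
    · exact update_le_update_iff.2 ⟨le_rfl, fun z _ =>
        update_le_update_iff.2 ⟨ha, fun w _ => le_rfl⟩ z⟩
    · exact update_le_update_iff.2 ⟨hb, fun z _ => le_rfl⟩

/-- The law of the configuration after a uniform redistribution on the bond `{x, y}`. -/
def bondMeasure (x y : ZMod N) (η : Config N) : Measure (Config N) :=
  uniformMixture (Finset.range (η x + η y + 1)) fun r => Measure.dirac (redistribute η x y r)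

instance (x y : ZMod N) (η : Config N) :
    IsProbabilityMeasure (bondMeasure x y η) :=
  isProbabilityMeasure_uniformMixture _ (by simp) _ fun _ => inferInstance

end Bond

/-! ### The KMP semigroup and its attractiveness -/

section Jump

variable (N : ℕ) [NeZero N]

/-- The kernel that redistributes uniformly on a uniformly chosen bond. -/
def jumpKernel : Kernel (Config N) (Config N) where
  toFun η := uniformMixture Finset.univ fun x : ZMod N => bondMeasure x (x + 1) η
  measurable' := .of_discrete

instance : IsMarkovKernel (jumpKernel N) :=
  ⟨fun _ => isProbabilityMeasure_uniformMixture _ Finset.univ_nonempty _ fun _ => inferInstance⟩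

lemma kernelOperator_jumpKernel_apply (f : Config N →ᵇ ℝ) (η : Config N) :
    kernelOperator (jumpKernel N) f η = (N : ℝ)⁻¹ * ∑ x : ZMod N, bondAverage x (x + 1) f η := by
  refine (integral_uniformMixture _ _ (fun _ => inferInstance) f ‖f‖ f.norm_coe_le_norm).trans ?_
  rw [Finset.card_univ, ZMod.card]
  congr 1
  refine Finset.sum_congr rfl fun x _ => ?_
  rw [bondMeasure, integral_uniformMixture _ _ (fun _ => inferInstance) f ‖f‖ f.norm_coe_le_norm]
  simp [bondAverage]

lemma monotone_kernelOperator_jumpKernel (f : Config N →ᵇ ℝ) (hf : Monotone f) :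
    Monotone (kernelOperator (jumpKernel N) f) := by
  intro η ξ h
  rw [kernelOperator_jumpKernel_apply, kernelOperator_jumpKernel_apply]
  exact mul_le_mul_of_nonneg_left
    (Finset.sum_le_sum fun x _ => monotone_bondAverage x (x + 1) hf h) (by positivity)

/-- The generator as a bounded operator on bounded functions. -/
def generatorOperator : (Config N →ᵇ ℝ) →L[ℝ] (Config N →ᵇ ℝ) :=
  (N : ℝ) • (kernelOperator (jumpKernel N) - 1)

lemma coe_generatorOperator (f : Config N →ᵇ ℝ) :
    ⇑(generatorOperator N f) = generator N f := by
  ext η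
  have hN : (N : ℝ) ≠ 0 := NeZero.ne _
  have : generatorOperator N f η = N * (kernelOperator (jumpKernel N) f η - f η) := rfl
  rw [this, kernelOperator_jumpKernel_apply, generator]
  simp_rw [bondGenerator_eq]
  rw [Finset.sum_sub_distrib, Finset.sum_const, Finset.card_univ, ZMod.card, nsmul_eq_mul]
  field_simp

lemma expSemigroup_generatorOperator (t : ℝ≥0) : expSemigroup (generatorOperator N) t =
    expSemigroup (kernelOperator (jumpKernel N) - 1) (t * N : ℝ≥0) := by
  rw [generatorOperator, expSemigroup_smul]
  simp

variable {N}

/-- Configurations form a discrete space, so bounded functions are exactly the bounded continuous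
ones, and uniform convergence is norm convergence. -/
lemma hasGenerator_iff (S : ℝ≥0 → Kernel (Config N) (Config N)) [∀ t, IsMarkovKernel (S t)] :
    HasGenerator S (generator N) ↔ ∀ f : Config N →ᵇ ℝ,
      Tendsto (fun t : ℝ≥0 => (t : ℝ)⁻¹ • (kernelOperator (S t) f - f)) (𝓝[>] 0)
        (𝓝 (generatorOperator N f)) := by
  have key (f : Config N →ᵇ ℝ) :
      Tendsto (fun t : ℝ≥0 => (t : ℝ)⁻¹ • (kernelOperator (S t) f - f)) (𝓝[>] 0)
        (𝓝 (generatorOperator N f)) ↔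
      TendstoUniformly (fun (t : ℝ≥0) (η : Config N) => ((∫ ξ, f ξ ∂(S t η)) - f η) / (t : ℝ))
        (generator N f) (𝓝[>] (0 : ℝ≥0)) := by
    rw [BoundedContinuousFunction.tendsto_iff_tendstoUniformly, coe_generatorOperator]
    have : (fun (t : ℝ≥0) (η : Config N) => ((∫ ξ, f ξ ∂(S t η)) - f η) / (t : ℝ)) =
        fun t : ℝ≥0 => ⇑((t : ℝ)⁻¹ • (kernelOperator (S t) f - f)) := by
      ext t η
      simp [div_eq_inv_mul]
    rw [this]
  refine ⟨fun h f => (key f).2 (h f ⟨‖f‖, f.norm_coe_le_norm⟩), fun h f ⟨C, hC⟩ => ?_⟩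
  exact (key (BoundedContinuousFunction.ofNormedAddCommGroupDiscrete f C hC)).1 (h _)

/-- A Markov semigroup with the discrete KMP generator is the exponential of this generator. -/
lemma IsMarkovSemigroup.kernelOperator_eq {S : ℝ≥0 → Kernel (Config N) (Config N)}
    [∀ t, IsMarkovKernel (S t)] (hS : IsMarkovSemigroup S)
    (hL : HasGenerator S (generator N)) (t : ℝ≥0) :
    kernelOperator (S t) = expSemigroup (generatorOperator N) t := by
  refine eq_expSemigroup_of_tendsto_generator (fun t => kernelOperator (S t)) _ ?_ (fun s t => ?_)
    (fun t => norm_kernelOperator_le _) ((hasGenerator_iff S).1 hL) t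
  · simp_rw [hS.zero]
    exact kernelOperator_id
  · simp_rw [← kernelOperator_comp, ← hS.add, add_comm]

variable (N) in
/-- The semigroup of the discrete KMP model. -/
def semigroup (t : ℝ≥0) : Kernel (Config N) (Config N) :=
  poissonKernel (jumpKernel N) (t * N)

instance (t : ℝ≥0) : IsMarkovKernel (semigroup N t) :=
  inferInstanceAs (IsMarkovKernel (poissonKernel _ _))

lemma kernelOperator_semigroup (t : ℝ≥0) :
    kernelOperator (semigroup N t) = expSemigroup (generatorOperator N) t := by
  rw [expSemigroup_generatorOperator, ← kernelOperator_poissonKernel]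
  rfl

variable (N) in
lemma isMarkovSemigroup_semigroup : IsMarkovSemigroup (semigroup N) where
  markov _ := inferInstance
  zero := by
    refine kernelOperator_injective _ _ ?_
    rw [kernelOperator_semigroup, kernelOperator_id, NNReal.coe_zero, expSemigroup_zero]
  add s t := by
    refine kernelOperator_injective _ _ ?_
    rw [kernelOperator_comp, kernelOperator_semigroup, kernelOperator_semigroup,
      kernelOperator_semigroup, NNReal.coe_add, add_comm, expSemigroup_add]

variable (N) in
lemma hasGenerator_semigroup : HasGenerator (semigroup N) (generator N) := by
  rw [hasGenerator_iff]
  intro f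
  simp_rw [kernelOperator_semigroup]
  exact tendsto_expSemigroup_generator _ f

lemma IsMarkovSemigroup.isAttractive {S : ℝ≥0 → Kernel (Config N) (Config N)}
    (hS : IsMarkovSemigroup S) (hL : HasGenerator S (generator N)) : IsAttractive S := by
  have := hS.markov
  intro μ₁ μ₂ _ _ hμ t f ⟨C, hC⟩ hf
  rw [integral_bind_of_bounded μ₁ (S t) f C hC, integral_bind_of_bounded μ₂ (S t) f C hC]
  set F : Config N →ᵇ ℝ := BoundedContinuousFunction.ofNormedAddCommGroupDiscrete f C hC
  refine hμ (kernelOperator (S t) F) ⟨_, (kernelOperator (S t) F).norm_coe_le_norm⟩ ?_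
  rw [hS.kernelOperator_eq hL, expSemigroup_generatorOperator]
  exact monotone_expSemigroup_kernelOperator _ (monotone_kernelOperator_jumpKernel N) _ F hf

end Jump

end DiscreteKMP

end

theorem mainTheorem3 (N : ℕ) [NeZero N] :
    (∃ S : ℝ≥0 → Kernel (DiscreteKMP.Config N) (DiscreteKMP.Config N),
      DiscreteKMP.IsMarkovSemigroup S ∧
        DiscreteKMP.HasGenerator S (DiscreteKMP.generator N)) ∧
    ∀ S : ℝ≥0 → Kernel (DiscreteKMP.Config N) (DiscreteKMP.Config N),
      DiscreteKMP.IsMarkovSemigroup S →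
      DiscreteKMP.HasGenerator S (DiscreteKMP.generator N) →
        DiscreteKMP.IsAttractive S :=
  ⟨⟨DiscreteKMP.semigroup N, DiscreteKMP.isMarkovSemigroup_semigroup N,
    DiscreteKMP.hasGenerator_semigroup N⟩, fun _ hS hL => hS.isAttractive hL⟩
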